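/- Let $Y$ be a (real) Banach space. For $k\ge 0$ let $T_k^\omega$ be the countably branching tree of height $k$: its vertices are the subsets $\{n_1<\dots<n_l\}$ of $\mathbb N$ with $l\le k$, written as increasing sequences $(n_1,\dots,n_l)$; each $(n_1,\dots,n_l,n_{l+1})$ is joined by an edge to $(n_1,\dots,n_l)$; and $T_k^\omega$ carries the shortest path metric. For a metric space $X$, let $c_Y(X)\in[0,\infty]$ be the $Y$-distortion of $X$, that is, the infimum of the constants $D\in[0,\infty)$ such that there exist $s>0$ and a map $f\colon X\to Y$ with $$s\, d_X(x,x')\le \|f(x)-f(x')\|\le sD\, d_X(x,x')\qquad\text{for all }x,x'\in X.$$ Let $\|\cdot\|_p$ denote the $\ell_p$-norm of finite sequences (the maximum norm if $p=\infty$). For $1\le p\le\infty$ we say that $Y$ has an $\ell_p$-asymptotic model (a $c_0$-asymptotic model if $p=\infty$) generated by a weakly null array if there are vectors $y^{(i)}_j\in Y$ ($i,j\in\mathbb N$) of norm one such that, for each $i$, the row $(y^{(i)}_j)_{j}$ converges weakly to $0$, and such that for every $k\in\mathbb N$ and $\delta>0$ one can pass to subsequences $(x^{(i)}_j)_j$ of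 the rows $(y^{(i)}_j)_j$ with $$\Bigg|\,\bigg\|\sum_{i=1}^k a_i x^{(i)}_{j_i}\bigg\|-\big\|(a_i)_{i=1}^k\big\|_p\Bigg|<\delta$$ for all $k\le j_1<\dots<j_k$ and all $a_1,\dots,a_k\in[-1,1]$. (1) If $Y$ has an $\ell_p$-asymptotic model generated by a weakly null array for some $p\in(1,\infty)$, then $c_Y(T_k^\omega)=O\big((\log k)^{1/p}\big)$; that is, there is a constant $C>0$ such that $c_Y(T_k^\omega)\le C(\log k)^{1/p}$ for all $k\ge 2$. (2) If $Y$ has an $\ell_1$-asymptotic model or a $c_0$-asymptotic model generated by a weakly null array, then $\sup_{k} c_Y(T_k^\omega)<\infty$. -/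

import Mathlib

open Filter Topology
open scoped NNReal ENNReal

/-- The vertex set `[ℕ]^{≤ k}` of the countably branching tree of height `k`: all sets of at most
`k` natural numbers.  Such a set stands for the strictly increasing sequence of its elements. -/
def OmegaTree (k : ℕ) : Type := {s : Finset ℕ // s.card ≤ k}

namespace OmegaTree

/-- `t` is a child of `s` in the tree: it arises from the increasing sequence `s` by appending one
larger term at the end. -/
def IsChild {k : ℕ} (s t : OmegaTree k) : Prop :=
  ∃ n : ℕ, (∀ m ∈ s.1, m < n) ∧ t.1 = insert n s.1

/-- The countably branching tree of height `k`, as a graph: every vertex is joined to its children. -/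
def graph (k : ℕ) : SimpleGraph (OmegaTree k) where
  Adj s t := s.IsChild t ∨ t.IsChild s
  symm := ⟨fun _ _ h => h.symm⟩
  loopless := ⟨by
    have key : ∀ s : OmegaTree k, ¬ s.IsChild s := by
      rintro s ⟨n, hn, hs⟩
      have h : n ∈ s.1 := by rw [hs]; exact Finset.mem_insert_self _ _
      exact lt_irrefl _ (hn n h)
    exact fun s h => h.elim (key s) (key s)⟩

theorem graph_connected (k : ℕ) : (graph k).Connected := by
  have key : ∀ (n : ℕ) (s : OmegaTree k), s.1.card = n →
      (graph k).Reachable ⟨∅, Nat.zero_le k⟩ s := by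
    intro n
    induction n with
    | zero =>
      intro s hs
      have : s = ⟨∅, Nat.zero_le k⟩ := Subtype.ext (Finset.card_eq_zero.1 hs)
      subst this
      exact SimpleGraph.Reachable.refl _
    | succ n ih =>
      intro s hs
      have hne : s.1.Nonempty := Finset.card_pos.1 (by omega)
      have hcard : (s.1.erase (s.1.max' hne)).card = n := by
        rw [Finset.card_erase_of_mem (s.1.max'_mem hne)]; omega
      have hk : (s.1.erase (s.1.max' hne)).card ≤ k := by
        have := s.2
        omega
      refine (ih ⟨_, hk⟩ hcard).trans (SimpleGraph.Adj.reachable (Or.inl ?_))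
      exact ⟨s.1.max' hne, fun m hm => s.1.lt_max'_of_mem_erase_max' hne hm,
        (Finset.insert_erase (s.1.max'_mem hne)).symm⟩
  have : Nonempty (OmegaTree k) := ⟨⟨∅, Nat.zero_le k⟩⟩
  exact ⟨fun s t => (key _ s rfl).symm.trans (key _ t rfl)⟩

/-- The tree metric, i.e. the shortest path metric of the graph. -/
noncomputable instance (k : ℕ) : MetricSpace (OmegaTree k) where
  dist s t := ((graph k).dist s t : ℝ)
  dist_self s := by simp
  dist_comm s t := by rw [SimpleGraph.dist_comm]
  dist_triangle s t u := by exact_mod_cast (graph_connected k).dist_triangle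
  eq_of_dist_eq_zero {s t} h := (graph_connected k).dist_eq_zero_iff.1 (by exact_mod_cast h)

end OmegaTree

/-- The `Y`-distortion of `X`: the infimum of the constants `D` for which there are a scaling
factor `s > 0` and a map `f : X → Y` with
`s * dist x y ≤ dist (f x) (f y) ≤ s * D * dist x y` for all `x y`
(and `∞` if there is no such `D`). -/
noncomputable def distortion (Y X : Type*) [MetricSpace Y] [MetricSpace X] : ℝ≥0∞ :=
  sInf {E : ℝ≥0∞ | ∃ D : ℝ≥0, E = (D : ℝ≥0∞) ∧ ∃ s : ℝ, 0 < s ∧ ∃ f : X → Y, ∀ x y : X,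
    s * dist x y ≤ dist (f x) (f y) ∧ dist (f x) (f y) ≤ s * (D : ℝ) * dist x y}

/-- `y i j` is the `j`-th term of the `i`-th row.  The array is normalized and weakly null: all
its terms have norm one and each of its rows is a weakly null sequence. -/
def IsNormalizedWeaklyNullArray {Y : Type*} [NormedAddCommGroup Y] [NormedSpace ℝ Y]
    (y : ℕ → ℕ → Y) : Prop :=
  (∀ i j, ‖y i j‖ = 1) ∧
    ∀ i, ∀ φ : StrongDual ℝ Y, Tendsto (fun j => φ (y i j)) atTop (𝓝 0)

/-- `Y` has an `ℓ_p`-asymptotic model generated by a weakly null array; for `p = ∞`, a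
`c₀`-asymptotic model.  The subsequences (one strictly increasing `σ i` for each row `i`) may depend
on `k` and `δ`; `‖WithLp.toLp p a‖` is the `ℓ_p`-norm of the finite sequence `a`, the maximum
of the `|a i|` if `p = ∞`. -/
def HasLpAsymptoticModel (Y : Type*) [NormedAddCommGroup Y] [NormedSpace ℝ Y]
    (p : ℝ≥0∞) : Prop :=
  ∃ y : ℕ → ℕ → Y, IsNormalizedWeaklyNullArray y ∧
    ∀ (k : ℕ) (δ : ℝ), 0 < δ → ∃ σ : ℕ → ℕ → ℕ, (∀ i, StrictMono (σ i)) ∧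
      ∀ j : Fin k → ℕ, StrictMono j → (∀ i, k ≤ j i) →
        ∀ a : Fin k → ℝ, (∀ i, |a i| ≤ 1) →
          |‖∑ i : Fin k, a i • y i (σ i (j i))‖ - ‖WithLp.toLp p a‖| < δ

/-! Send a vertex `s` to the sum, over its nonempty initial segments `v`, of `c (|s| - |v|)` times a
vector in row `|v| - 1` of the array. The column is an injective code of `v` that increases along
branches. Along a single branch the asymptotic model makes norms nearly `ℓ_p`-norms. The images of
adjacent vertices differ by a combination along one branch with coefficients `d j = c j - c (j -
1)`, so the Lipschitz constant is about the `ℓ_p`-norm of `d`. For the lower bound, `f s - f t` is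
supported on two branches, about which the model says nothing directly. Weak nullity helps: after
passing to a subsequence, deleting terms from a short sum increases its norm by at most a small
error (`exists_subseq_suppression`). Deleting everything outside the part of the branch of `s`
beyond the meet leaves a combination along one branch, with coefficients `c 0, c 1, ...`. If its
norm is at least `κ` times the number of terms, the distortion is at most `4 (K + κ) / κ`
(`distortion_omegaTree_le`). It remains to choose `c`. With `c j = (j + 1) ^ (1 - 1 / p)` the sum of
`|c j| ^ p` over `j < L` has order `L ^ p`, while `|d j| ^ p ≤ 1 / (j + 1)` sums to about `log k`.
For `ℓ_1` the constant sequence works, for `c₀` the sequence `j + 1`; then both estimates are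
uniform in `k`. -/

/-! ### Iterated limits and suppression for weakly null arrays -/

section Suppression

variable {Y : Type*} [NormedAddCommGroup Y] [NormedSpace ℝ Y] {ι : Type*}

/-- A convex Lipschitz function is weakly lower semicontinuous along an ultrafilter. -/
theorem le_of_tendsto_of_convexOn_of_weaklyNull {G : Y → ℝ} (hG : LipschitzWith 1 G)
    (hc : ConvexOn ℝ Set.univ G) {l : Filter ℕ} [l.NeBot] {v : ℕ → Y}
    (hv : ∀ φ : StrongDual ℝ Y, Tendsto (fun n => φ (v n)) l (𝓝 0)) {x : Y} {b : ℝ}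
    (hb : Tendsto (fun n => G (x + v n)) l (𝓝 b)) : G x ≤ b := by
  by_contra! hlt
  -- A closed convex sublevel set is weakly closed. It eventually contains `x + v n`, which tends
  -- weakly to `x`, yet a functional separates `x` from it.
  obtain ⟨c, hbc, hcx⟩ := exists_between hlt
  have hconv : Convex ℝ {y | G y ≤ c} := by simpa using hc.convex_le c
  have hclosed : IsClosed {y | G y ≤ c} := isClosed_le hG.continuous continuous_const
  obtain ⟨φ, r, hx, hr⟩ := geometric_hahn_banach_point_closed hconv hclosed
    (show x ∉ {y | G y ≤ c} from not_le.2 hcx)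
  have h1 : ∀ᶠ n in l, G (x + v n) ≤ c := (hb.eventually (gt_mem_nhds hbc)).mono fun _ h => le_of_lt h
  have h2 : Tendsto (fun n => φ (x + v n)) l (𝓝 (φ x)) := by
    simpa using (hv φ).const_add (φ x)
  have h3 : r ≤ φ x := ge_of_tendsto h2 (h1.mono fun n hn => (hr _ hn).le)
  exact absurd hx (not_lt.2 h3)

/-- The iterated limit of `‖x + u a₁ n₁ + ⋯ + u aₘ nₘ‖` along a free ultrafilter. -/
noncomputable def iterLim (u : ι → ℕ → Y) : List ι → Y → ℝ
  | [], x => ‖x‖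
  | a :: w, x => limUnder (hyperfilter ℕ : Filter ℕ) fun n => iterLim u w (x + u a n)

variable {u : ι → ℕ → Y}

-- The values stay in a compact interval, so an ultrafilter makes them converge; no subsequence has
-- to be extracted.
omit [NormedSpace ℝ Y] in
theorem tendsto_limUnder_of_lipschitz {G : Y → ℝ} (hG : LipschitzWith 1 G) {v : ℕ → Y}
    (hv : ∃ M, ∀ n, ‖v n‖ ≤ M) (x : Y) :
    Tendsto (fun n => G (x + v n)) (hyperfilter ℕ)
      (𝓝 (limUnder (hyperfilter ℕ : Filter ℕ) fun n => G (x + v n))) := by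
  apply tendsto_nhds_limUnder
  obtain ⟨M, hM⟩ := hv
  have hmem : ∀ n, G (x + v n) ∈ Set.Icc (G x - M) (G x + M) := by
    intro n
    have h := hG.dist_le_mul (x + v n) x
    rw [Real.dist_eq, dist_eq_norm] at h
    simp only [NNReal.coe_one, one_mul, add_sub_cancel_left] at h
    have := abs_le.1 (h.trans (hM n))
    constructor <;> linarith
  obtain ⟨b, -, hb⟩ := (isCompact_Icc (a := G x - M) (b := G x + M)).ultrafilter_le_nhds
    ((hyperfilter ℕ).map fun n => G (x + v n)) (by
      rw [le_principal_iff]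
      exact Filter.mem_map.2 (Filter.univ_mem' hmem))
  exact ⟨b, hb⟩

/-- Both properties survive translation and pointwise limits, so they pass from the norm to every
iterated limit. -/
theorem iterLim_lipschitz_convex (hu : ∀ a, ∃ M, ∀ n, ‖u a n‖ ≤ M) (w : List ι) :
    LipschitzWith 1 (iterLim u w) ∧ ConvexOn ℝ Set.univ (iterLim u w) := by
  induction w with
  | nil => exact ⟨lipschitzWith_one_norm, convexOn_univ_norm⟩
  | cons a w ih =>
    have ht := fun x => tendsto_limUnder_of_lipschitz ih.1 (hu a) x
    constructor
    · refine LipschitzWith.of_dist_le_mul fun x y => ?_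
      refine le_of_tendsto ((ht x).dist (ht y)) (Eventually.of_forall fun n => ?_)
      simpa using ih.1.dist_le_mul (x + u a n) (y + u a n)
    · refine ⟨convex_univ, fun x _ y _ s t hs ht' hst => ?_⟩
      refine le_of_tendsto_of_tendsto' (ht (s • x + t • y))
        (((ht x).const_smul s).add ((ht y).const_smul t)) fun n => ?_
      have h := ih.2.2 (Set.mem_univ (x + u a n)) (Set.mem_univ (y + u a n)) hs ht' hst
      have e : s • x + t • y + u a n = s • (x + u a n) + t • (y + u a n) := by
        rw [smul_add, smul_add, add_add_add_comm, ← add_smul, hst, one_smul]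
      rw [e]
      exact h

theorem tendsto_iterLim (hu : ∀ a, ∃ M, ∀ n, ‖u a n‖ ≤ M) (a : ι) (w : List ι) (x : Y) :
    Tendsto (fun n => iterLim u w (x + u a n)) (hyperfilter ℕ) (𝓝 (iterLim u (a :: w) x)) :=
  tendsto_limUnder_of_lipschitz (iterLim_lipschitz_convex hu w).1 (hu a) x

/-- This is suppression in the limit: each deleted letter is a weakly null perturbation, under which
a convex Lipschitz function cannot drop in the limit. -/
theorem iterLim_mono (hu : ∀ a, ∃ M, ∀ n, ‖u a n‖ ≤ M)
    (hnull : ∀ a, ∀ φ : StrongDual ℝ Y, Tendsto (fun n => φ (u a n)) atTop (𝓝 0))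
    {w' w : List ι} (h : w'.Sublist w) (x : Y) : iterLim u w' x ≤ iterLim u w x := by
  have hle : (hyperfilter ℕ : Filter ℕ) ≤ atTop := Nat.hyperfilter_le_atTop
  induction h generalizing x with
  | slnil => exact le_rfl
  | cons a _ ih =>
    refine (ih x).trans ?_
    obtain ⟨h1, h2⟩ := iterLim_lipschitz_convex hu (u := u) (by assumption)
    exact le_of_tendsto_of_convexOn_of_weaklyNull h1 h2 (fun φ => (hnull a φ).mono_left hle)
      (tendsto_iterLim hu a _ x)
  | cons_cons a _ ih =>
    exact le_of_tendsto_of_tendsto' (tendsto_iterLim hu a _ x) (tendsto_iterLim hu a _ x)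
      fun n => ih _

theorem finite_lists_le (T : Finset ι) (N : ℕ) :
    {w : List ι | (∀ a ∈ w, a ∈ T) ∧ w.length ≤ N}.Finite := by
  refine ((List.finite_length_le T N).image (List.map Subtype.val)).subset ?_
  rintro w ⟨h1, h2⟩
  lift w to List T using h1
  exact ⟨w, by simpa using h2, rfl⟩

/-- Along a suitable subsequence the norms of short sums are close to the iterated limits. -/
theorem exists_subseq_near_iterLim (hu : ∀ a, ∃ M, ∀ n, ‖u a n‖ ≤ M) (T : Finset ι) (N : ℕ)
    {ε : ℝ} (hε : 0 < ε) :
    ∃ φ : ℕ → ℕ, StrictMono φ ∧ ∀ L : List (ι × ℕ), (∀ e ∈ L, e.1 ∈ T) → L.length ≤ N →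
      L.Pairwise (fun e e' => e.2 < e'.2) →
      |‖(L.map fun e => u e.1 (φ e.2)).sum‖ - iterLim u (L.map Prod.fst) 0| ≤ L.length * ε := by
  classical
  -- Only finitely many base points, letters and words occur, so a single `n` serves them all.
  have step : ∀ (X : Finset Y) (m : ℕ), ∃ n, m < n ∧ ∀ x ∈ X, ∀ a ∈ T, ∀ w : List ι,
      ((∀ a ∈ w, a ∈ T) ∧ w.length ≤ N) →
        |iterLim u w (x + u a n) - iterLim u (a :: w) x| ≤ ε := by
    intro X m
    have h1 : ∀ᶠ n in (hyperfilter ℕ : Filter ℕ), m < n :=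
      Nat.hyperfilter_le_atTop (eventually_gt_atTop m)
    have h2 : ∀ᶠ n in (hyperfilter ℕ : Filter ℕ), ∀ x ∈ X, ∀ a ∈ T,
        ∀ w ∈ {w : List ι | (∀ a ∈ w, a ∈ T) ∧ w.length ≤ N},
        |iterLim u w (x + u a n) - iterLim u (a :: w) x| ≤ ε := by
      rw [Finset.eventually_all]
      intro x _
      rw [Finset.eventually_all]
      intro a _
      rw [Set.Finite.eventually_all (finite_lists_le T N)]
      intro w _
      exact ((tendsto_iterLim hu a w x).eventually (Metric.closedBall_mem_nhds _ hε)).mono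
        fun n hn => by simpa [Real.dist_eq] using hn
    exact (h1.and h2).exists
  choose g hg1 hg2 using step
  -- The state at `n` holds all partial sums that can be formed from earlier choices, together with
  -- the `n`-th chosen index, which is good for all of them.
  let st : ℕ → Finset Y × ℕ := fun n => Nat.rec ({0}, g {0} 0)
    (fun _ p => let X := p.1 ∪ T.biUnion fun a => p.1.image fun x => x + u a p.2
      (X, g X p.2)) n
  have hst : ∀ n, (st (n + 1)).1 =
      (st n).1 ∪ T.biUnion fun a => (st n).1.image fun x => x + u a (st n).2 := fun _ => rfl
  have hst2 : ∀ n, (st (n + 1)).2 = g (st (n + 1)).1 (st n).2 := fun _ => rfl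
  have hmono : Monotone fun n => (st n).1 :=
    monotone_nat_of_le_succ fun n => by
      rw [hst]; exact Finset.subset_union_left
  have hgood : ∀ n, ∀ x ∈ (st n).1, ∀ a ∈ T, ∀ w : List ι,
      ((∀ a ∈ w, a ∈ T) ∧ w.length ≤ N) →
        |iterLim u w (x + u a (st n).2) - iterLim u (a :: w) x| ≤ ε := by
    intro n
    cases n with
    | zero => exact hg2 {0} 0
    | succ n => rw [hst2]; exact hg2 _ _
  have key : ∀ L : List (ι × ℕ), (∀ e ∈ L, e.1 ∈ T) → L.length ≤ N →
      L.Pairwise (fun e e' => e.2 < e'.2) → ∀ m, (∀ e ∈ L, m ≤ e.2) → ∀ x ∈ (st m).1,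
      |‖x + (L.map fun e => u e.1 (st e.2).2).sum‖ - iterLim u (L.map Prod.fst) x|
        ≤ L.length * ε := by
    intro L
    induction L with
    | nil => intro _ _ _ m _ x _; simp [iterLim]
    | cons e L ih =>
      intro hT hN hP m hm x hx
      obtain ⟨hP1, hP2⟩ := List.pairwise_cons.1 hP
      have hx' : x ∈ (st e.2).1 := hmono (hm e (by simp)) hx
      have heT : e.1 ∈ T := hT e (by simp)
      have hLT : ∀ e ∈ L, e.1 ∈ T := fun e' he' => hT e' (by simp [he'])
      simp only [List.length_cons] at hN
      have hx2 : x + u e.1 (st e.2).2 ∈ (st (e.2 + 1)).1 := by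
        rw [hst]
        exact Finset.mem_union_right _ (Finset.mem_biUnion.2
          ⟨e.1, heT, Finset.mem_image_of_mem _ hx'⟩)
      have h1 := ih hLT (by omega) hP2 (e.2 + 1) (fun e' he' => hP1 e' he') _ hx2
      have h2 := hgood e.2 x hx' e.1 heT (L.map Prod.fst)
        ⟨by simpa using fun a b hab => hLT (a, b) hab, by simp; omega⟩
      simp only [List.map_cons, List.sum_cons, List.length_cons, ← add_assoc]
      push_cast
      have := abs_sub_le ‖x + u e.1 (st e.2).2 + (L.map fun e => u e.1 (st e.2).2).sum‖
        (iterLim u (L.map Prod.fst) (x + u e.1 (st e.2).2))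
        (iterLim u (e.1 :: L.map Prod.fst) x)
      linarith
  refine ⟨fun n => (st n).2, strictMono_nat_of_lt_succ fun n => ?_, fun L hT hN hP => ?_⟩
  · rw [hst2]; exact hg1 _ _
  · simpa using key L hT hN hP 0 (by simp) 0 (by simp [st])

/-- Suppression unconditionality of weakly null arrays along a subsequence. -/
theorem exists_subseq_suppression {V : Type*} (hu : ∀ a, ∃ M, ∀ n, ‖u a n‖ ≤ M)
    (hnull : ∀ a, ∀ φ : StrongDual ℝ Y, Tendsto (fun n => φ (u a n)) atTop (𝓝 0))
    (T : Finset ι) (N : ℕ) {ε : ℝ} (hε : 0 < ε) {code : V → ℕ} (hcode : Function.Injective code) :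
    ∃ φ : ℕ → ℕ, StrictMono φ ∧ ∀ (ℓ : V → ι) (F F' : Finset V), F' ⊆ F → F.card ≤ N →
      (∀ v ∈ F, ℓ v ∈ T) →
      ‖∑ v ∈ F', u (ℓ v) (φ (code v))‖ ≤ ‖∑ v ∈ F, u (ℓ v) (φ (code v))‖ + ε := by
  classical
  -- At most `N` letters then cost at most `ε / 2`, and two sums are compared. The `+ 1` covers `N =
  -- 0`.
  obtain ⟨φ, hφ, h⟩ := exists_subseq_near_iterLim hu T N (ε := ε / (2 * N + 1)) (by positivity)
  refine ⟨φ, hφ, fun ℓ F F' hF' hN hT => ?_⟩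
  let r : V → V → Prop := fun v w => code v ≤ code w
  have : DecidableRel r := fun _ _ => inferInstanceAs (Decidable (_ ≤ _))
  have : IsTrans V r := ⟨fun a b c h h' => le_trans (α := ℕ) h h'⟩
  have : Std.Antisymm r := ⟨fun a b h h' => hcode (le_antisymm h h')⟩
  have : Std.Total r := ⟨fun a b => le_total (code a) (code b)⟩
  let L : Finset V → List (ι × ℕ) := fun S => (S.sort r).map fun v => (ℓ v, code v)
  have hsum : ∀ S, ((L S).map fun e => u e.1 (φ e.2)).sum = ∑ v ∈ S, u (ℓ v) (φ (code v)) := by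
    intro S
    simp only [L, List.map_map]
    rw [← List.sum_toFinset _ (S.sort_nodup r), Finset.sort_toFinset]
    rfl
  have hfst : ∀ S, (L S).map Prod.fst = (S.sort r).map ℓ := fun S => by
    simp [L, Function.comp_def]
  have hpw : ∀ S, (L S).Pairwise (fun e e' => e.2 < e'.2) := by
    intro S
    refine List.pairwise_map.2 ?_
    refine ((S.pairwise_sort r).and (S.sort_nodup r)).imp ?_
    exact fun {a b} hab => lt_of_le_of_ne hab.1 fun h => hab.2 (hcode h)
  have main : ∀ S ⊆ F, |‖∑ v ∈ S, u (ℓ v) (φ (code v))‖ - iterLim u ((S.sort r).map ℓ) 0|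
      ≤ ε / 2 := by
    intro S hS
    have hlen : (L S).length = S.card := by simp [L]
    have hc := (Finset.card_le_card hS).trans hN
    have := h (L S) (by simpa [L] using fun v hv => hT v (hS hv)) (hlen ▸ hc) (hpw S)
    rw [hsum, hfst, hlen] at this
    refine this.trans ?_
    have h3 : (S.card : ℝ) ≤ N := by exact_mod_cast hc
    rw [mul_div_assoc', div_le_div_iff₀ (by positivity) (by norm_num)]
    nlinarith
  have hsub : (F'.sort r).Sublist (F.sort r) := by
    refine List.sublist_of_subperm_of_pairwise (r := r) ?_ (F'.pairwise_sort r) (F.pairwise_sort r)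
    exact (F'.sort_nodup r).subperm fun v hv => by
      rw [Finset.mem_sort] at hv ⊢; exact hF' hv
  have h1 := abs_le.1 (main F' hF')
  have h2 := abs_le.1 (main F subset_rfl)
  have h3 := iterLim_mono hu hnull (hsub.map ℓ) 0
  linarith

end Suppression

/-! ### Initial segments, branches and their meets -/

section InitialSegments

/-- The set of the first `i` elements of `s`. -/
def seg (s : Finset ℕ) (i : ℕ) : Finset ℕ := (s.sort.take i).toFinset

theorem sort_seg (s : Finset ℕ) (i : ℕ) : (seg s i).sort = s.sort.take i := by
  have hn : (s.sort.take i).Nodup := (s.sort_nodup _).sublist (List.take_sublist _ _)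
  exact (List.toFinset_sort (· ≤ ·) hn).2 ((s.pairwise_sort _).sublist (List.take_sublist _ _))

theorem card_seg {s : Finset ℕ} {i : ℕ} (hi : i ≤ s.card) : (seg s i).card = i := by
  rw [← Finset.length_sort (· ≤ ·), sort_seg, List.length_take, Finset.length_sort]
  omega

theorem seg_seg (s : Finset ℕ) {i j : ℕ} (hij : i ≤ j) : seg (seg s j) i = seg s i := by
  rw [seg, sort_seg, List.take_take, min_eq_left hij, seg]

theorem seg_card (s : Finset ℕ) : seg s s.card = s := by
  rw [seg, ← Finset.length_sort (· ≤ ·), List.take_length, Finset.sort_toFinset]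

theorem seg_zero (s : Finset ℕ) : seg s 0 = ∅ := by simp [seg]

theorem seg_insert {s : Finset ℕ} {n : ℕ} (hn : ∀ m ∈ s, m < n) :
    seg (insert n s) s.card = s := by
  have hsort : (insert n s).sort = s.sort ++ [n] := by
    have hnd : (s.sort ++ [n]).Nodup := by
      refine List.nodup_append.2 ⟨(s.sort_nodup _), List.nodup_singleton n, ?_⟩
      intro a ha b hb
      rw [Finset.mem_sort] at ha
      rw [List.mem_singleton] at hb
      exact hb ▸ (hn a ha).ne
    have := (List.toFinset_sort (· ≤ ·) hnd).2 (List.pairwise_append.2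
      ⟨(s.pairwise_sort _), List.pairwise_singleton _ _, fun a ha b hb => by
        rw [Finset.mem_sort] at ha
        rw [List.mem_singleton] at hb
        exact hb ▸ (hn a ha).le⟩)
    rw [← this]
    congr 1
    ext a
    simp
  rw [seg, hsort, List.take_append_of_le_length (by simp), ← Finset.length_sort (· ≤ ·),
    List.take_length, Finset.sort_toFinset]

theorem exists_seg_succ {s : Finset ℕ} {i : ℕ} (hi : i < s.card) :
    ∃ n, (∀ m ∈ seg s i, m < n) ∧ seg s (i + 1) = insert n (seg s i) := by
  have hi' : i < s.sort.length := by simpa using hi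
  have htake : s.sort.take (i + 1) = s.sort.take i ++ [s.sort[i]] := by
    rw [List.take_succ_eq_append_getElem hi']
  refine ⟨s.sort[i], fun m hm => ?_, ?_⟩
  · have h := (s.sortedLT_sort.pairwise).sublist (List.take_sublist (i + 1) _)
    rw [htake, List.pairwise_append] at h
    exact h.2.2 m (by simpa [seg] using hm) _ (by simp)
  · ext a
    rw [seg, htake, seg, List.mem_toFinset, List.mem_append, Finset.mem_insert,
      List.mem_toFinset, List.mem_singleton, or_comm]

theorem seg_ssubset {s : Finset ℕ} {i j : ℕ} (hij : i < j) (hj : j ≤ s.card) :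
    seg s i ⊂ seg s j := by
  refine Finset.ssubset_iff_subset_ne.2 ⟨fun a ha => ?_, fun h => ?_⟩
  · simp only [seg, List.mem_toFinset] at ha ⊢
    exact (List.take_sublist_take_left hij.le).subset ha
  · have := congrArg Finset.card h
    rw [card_seg (by omega), card_seg hj] at this
    omega

/-- The nonempty initial segments of `s`. -/
def branch (s : Finset ℕ) : Finset (Finset ℕ) :=
  (Finset.range s.card).image fun i => seg s (i + 1)

theorem sum_branch {M : Type*} [AddCommMonoid M] (s : Finset ℕ) (g : Finset ℕ → M) :
    ∑ v ∈ branch s, g v = ∑ i ∈ Finset.range s.card, g (seg s (i + 1)) := by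
  refine Finset.sum_image fun i hi j hj h => ?_
  have := congrArg Finset.card h
  simp only [Finset.coe_range, Set.mem_Iio] at hi hj
  rw [card_seg (by omega), card_seg (by omega)] at this
  omega

theorem mem_branch {s v : Finset ℕ} : v ∈ branch s ↔ ∃ i < s.card, seg s (i + 1) = v := by
  simp [branch]

theorem card_branch_le (s : Finset ℕ) : (branch s).card ≤ s.card := by
  simpa [branch] using Finset.card_image_le (s := Finset.range s.card) (f := fun i => seg s (i + 1))

theorem card_of_mem_branch {s v : Finset ℕ} (hv : v ∈ branch s) : 1 ≤ v.card ∧ v.card ≤ s.card := by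
  obtain ⟨i, hi, rfl⟩ := mem_branch.1 hv
  rw [card_seg (by omega)]
  omega

/-- Two finite sets branch off at some common initial segment. -/
theorem exists_meet (s t : Finset ℕ) : ∃ m, m ≤ s.card ∧ m ≤ t.card ∧ seg s m = seg t m ∧
    (∀ i < s.card, seg s (i + 1) ∈ branch t ↔ i < m) ∧
    (∀ i < t.card, seg t (i + 1) ∈ branch s ↔ i < m) := by
  classical
  -- The witness is the greatest length of a common initial segment. Cardinality forces equal
  -- initial segments of `s` and `t` to have equal length.
  let P : ℕ → Prop := fun m => m ≤ t.card ∧ seg s m = seg t m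
  have h0 : P 0 := ⟨Nat.zero_le _, by rw [seg_zero, seg_zero]⟩
  have hm1 : Nat.findGreatest P s.card ≤ s.card := Nat.findGreatest_le _
  have hm2 : P (Nat.findGreatest P s.card) := Nat.findGreatest_spec (Nat.zero_le _) h0
  have hm3 : ∀ i, i ≤ s.card → P i → i ≤ Nat.findGreatest P s.card :=
    fun i hi hP => Nat.le_findGreatest hi hP
  generalize Nat.findGreatest P s.card = m at *
  have heq : ∀ i ≤ m, seg s i = seg t i := fun i hi => by
    rw [← seg_seg s hi, hm2.2, seg_seg t hi]
  refine ⟨m, hm1, hm2.1, hm2.2, fun i hi => ⟨fun h => ?_, fun h => ?_⟩,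
    fun i hi => ⟨fun h => ?_, fun h => ?_⟩⟩
  · obtain ⟨j, hj, hij⟩ := mem_branch.1 h
    have hc := congrArg Finset.card hij
    rw [card_seg (by omega), card_seg (by omega)] at hc
    rw [hc] at hij
    exact hm3 (i + 1) hi ⟨by omega, hij.symm⟩
  · exact mem_branch.2 ⟨i, lt_of_lt_of_le h hm2.1, (heq _ h).symm⟩
  · obtain ⟨j, hj, hij⟩ := mem_branch.1 h
    have hc := congrArg Finset.card hij
    rw [card_seg (by omega), card_seg (by omega)] at hc
    rw [hc] at hij
    exact hm3 (i + 1) (by omega) ⟨by omega, hij⟩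
  · exact mem_branch.2 ⟨i, lt_of_lt_of_le h hm1, heq _ h⟩

/-- An injective, increasing numbering of the finite sets of natural numbers. -/
def binaryCode (v : Finset ℕ) : ℕ := ∑ n ∈ v, 2 ^ n

theorem binaryCode_injective : Function.Injective binaryCode := Finset.geomSum_injective le_rfl

theorem binaryCode_lt {v w : Finset ℕ} (h : v ⊂ w) : binaryCode v < binaryCode w := by
  obtain ⟨a, ha, hav⟩ := Finset.exists_of_ssubset h
  exact Finset.sum_lt_sum_of_subset h.1 ha hav (by positivity) fun _ _ _ => Nat.zero_le _

end InitialSegments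

/-! ### Estimates for the tree metric -/

namespace OmegaTree

theorem dist_le_of_isChild {k : ℕ} {s t : OmegaTree k} (h : s.IsChild t) : dist s t ≤ 1 := by
  have : (graph k).dist s t = 1 := SimpleGraph.dist_eq_one_iff_adj.2 (Or.inl h)
  change ((graph k).dist s t : ℝ) ≤ 1
  simp [this]

theorem dist_seg_le {k : ℕ} (s t : OmegaTree k) (d i : ℕ) (hd : i + d = s.1.card)
    (ht : t.1 = seg s.1 i) : dist t s ≤ d := by
  induction d generalizing t i with
  | zero =>
    have : t = s := Subtype.ext (by rw [ht, show i = s.1.card by omega, seg_card])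
    simp [this]
  | succ d ih =>
    have hi : i < s.1.card := by omega
    let t' : OmegaTree k := ⟨seg s.1 (i + 1), by rw [card_seg hi]; exact le_trans hi s.2⟩
    have h1 := ih t' (i + 1) (by omega) rfl
    obtain ⟨n, hn, he⟩ := exists_seg_succ hi
    have h2 : dist t t' ≤ 1 := dist_le_of_isChild ⟨n, by rwa [ht], by rw [ht]; exact he⟩
    have := dist_triangle t t' s
    push_cast
    linarith

theorem dist_le_of_seg_eq {k : ℕ} (s t : OmegaTree k) {m : ℕ} (hs : m ≤ s.1.card)
    (ht : m ≤ t.1.card) (h : seg s.1 m = seg t.1 m) :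
    dist s t ≤ ((s.1.card - m : ℕ) : ℝ) + ((t.1.card - m : ℕ) : ℝ) := by
  let r : OmegaTree k := ⟨seg s.1 m, by rw [card_seg hs]; exact hs.trans s.2⟩
  have h1 := dist_seg_le s r (s.1.card - m) m (by omega) rfl
  have h2 := dist_seg_le t r (t.1.card - m) m (by omega) h
  exact (dist_triangle_left s t r).trans (add_le_add h1 h2)

theorem one_le_dist {k : ℕ} {s t : OmegaTree k} (h : s ≠ t) : 1 ≤ dist s t := by
  have : 0 < (graph k).dist s t := (graph_connected k).pos_dist_of_ne h
  change (1 : ℝ) ≤ ((graph k).dist s t : ℝ)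
  exact_mod_cast this

/-- A map is Lipschitz if it is so along the edges. -/
theorem dist_le_of_forall_isChild {k : ℕ} {Y : Type*} [MetricSpace Y] {f : OmegaTree k → Y} {K : ℝ}
    (h : ∀ s t : OmegaTree k, s.IsChild t → dist (f s) (f t) ≤ K) (s t : OmegaTree k) :
    dist (f s) (f t) ≤ K * dist s t := by
  obtain ⟨w, hw⟩ := (graph_connected k).exists_walk_length_eq_dist s t
  have key : ∀ {a b : OmegaTree k} (w : (graph k).Walk a b), dist (f a) (f b) ≤ K * w.length := by
    intro a b w
    induction w with
    | nil => simp
    | @cons a b c hab w ih =>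
      have h1 : dist (f a) (f b) ≤ K := hab.elim (h a b) fun hba => by
        rw [dist_comm]; exact h b a hba
      have h2 := dist_triangle (f a) (f b) (f c)
      rw [SimpleGraph.Walk.length_cons]
      push_cast
      linarith
  change dist (f s) (f t) ≤ K * ((graph k).dist s t : ℝ)
  rw [← hw]
  exact key w

end OmegaTree

/-! ### The embedding and its distortion -/

section Embedding

variable {Y : Type*} [NormedAddCommGroup Y] [NormedSpace ℝ Y]

/-- The subsequences of an asymptotic model may be chosen for coefficients from `[-M, M]`. -/
theorem HasLpAsymptoticModel.exists_array {p : ℝ≥0∞} [Fact (1 ≤ p)]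
    (h : HasLpAsymptoticModel Y p) (k : ℕ) {M δ : ℝ} (hM : 0 < M) (hδ : 0 < δ) :
    ∃ z : ℕ → ℕ → Y, IsNormalizedWeaklyNullArray z ∧
      ∀ j : Fin k → ℕ, StrictMono j → (∀ i, k ≤ j i) →
        ∀ a : Fin k → ℝ, (∀ i, |a i| ≤ M) →
          |‖∑ i : Fin k, a i • z i (j i)‖ - ‖WithLp.toLp p a‖| < δ := by
  obtain ⟨y, ⟨hy1, hy2⟩, hy⟩ := h
  obtain ⟨σ, hσ, hm⟩ := hy k (δ / M) (by positivity)
  refine ⟨fun i j => y i (σ i j), ⟨fun i j => hy1 _ _, fun i φ =>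
    (hy2 i φ).comp (hσ i).tendsto_atTop⟩, fun j hj hk a ha => ?_⟩
  have h1 := hm j hj hk (fun i => M⁻¹ * a i) fun i => by
    rw [abs_mul, abs_of_pos (inv_pos.2 hM), inv_mul_le_iff₀ hM, mul_one]
    exact ha i
  have h2 : ∑ i : Fin k, (M⁻¹ * a i) • y i (σ i (j i)) =
      M⁻¹ • ∑ i : Fin k, a i • y i (σ i (j i)) := by
    rw [Finset.smul_sum]
    exact Finset.sum_congr rfl fun i _ => mul_smul _ _ _
  have h3 : WithLp.toLp p (fun i : Fin k => M⁻¹ * a i) = M⁻¹ • WithLp.toLp p a := rfl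
  rw [h2, h3, norm_smul, norm_smul, Real.norm_of_nonneg (inv_pos.2 hM).le, ← mul_sub, abs_mul,
    abs_of_pos (inv_pos.2 hM), inv_mul_lt_iff₀ hM, mul_div_cancel₀ _ hM.ne'] at h1
  exact h1

/-- The norm of a linear combination along a branch of the tree. -/
theorem abs_norm_branch_sub_lt {p : ℝ≥0∞} {k : ℕ} {z : ℕ → ℕ → Y} {M δ : ℝ} (hM : 0 ≤ M)
    (hz : ∀ j : Fin k → ℕ, StrictMono j → (∀ i, k ≤ j i) → ∀ a : Fin k → ℝ, (∀ i, |a i| ≤ M) →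
      |‖∑ i : Fin k, a i • z i (j i)‖ - ‖WithLp.toLp p a‖| < δ)
    {g : Finset ℕ → ℕ} (hg : ∀ v w, v ⊂ w → g v < g w) (hgk : ∀ v, k ≤ g v)
    {s : Finset ℕ} (hs : s.card ≤ k) (a : ℕ → ℝ) (ha : ∀ i < s.card, |a i| ≤ M) :
    |‖∑ i ∈ Finset.range s.card, a i • z i (g (seg s (i + 1)))‖ -
      ‖WithLp.toLp p (fun i : Fin k => if (i : ℕ) < s.card then a i else 0)‖| < δ := by
  -- The model needs exactly `k` increasing columns; those past the end of the branch carry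
  -- coefficient zero.
  let j : ℕ → ℕ := fun i => if i < s.card then g (seg s (i + 1)) else g s + 1 + i
  have hle : ∀ i < s.card, g (seg s (i + 1)) ≤ g s := by
    intro i hi
    rcases Nat.lt_or_ge (i + 1) s.card with h | h
    · have := hg _ _ (seg_ssubset h le_rfl)
      rw [seg_card] at this
      exact this.le
    · rw [show i + 1 = s.card by omega, seg_card]
  have hj : StrictMono j := by
    intro i i' hii
    simp only [j]
    split_ifs with h1 h2
    · exact hg _ _ (seg_ssubset (by omega) h2)
    · have := hle i h1
      omega
    · omega
    · omega
  have hjk : ∀ i, k ≤ j i := by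
    intro i
    simp only [j]
    split_ifs
    · exact hgk _
    · have := hgk s
      omega
  have h := hz (fun i => j i) (fun i i' hii => hj hii) (fun i => hjk i)
    (fun i => if (i : ℕ) < s.card then a i else 0) fun i => by
      split_ifs with hi
      · exact ha i hi
      · simpa using hM
  have hsum : ∑ i : Fin k, (if (i : ℕ) < s.card then a i else 0) • z i (j i) =
      ∑ i ∈ Finset.range s.card, a i • z i (g (seg s (i + 1))) := by
    rw [Fin.sum_univ_eq_sum_range (fun i => (if i < s.card then a i else 0) • z i (j i)) k]
    have hsub : Finset.range s.card ⊆ Finset.range k := Finset.range_subset_range.2 hs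
    rw [← Finset.sum_subset hsub fun i _ hi => by
      rw [if_neg (by simpa using hi), zero_smul]]
    refine Finset.sum_congr rfl fun i hi => ?_
    have hi' := Finset.mem_range.1 hi
    simp only [j, if_pos hi']
  rwa [hsum] at h

/-- An estimate of the distortion from the growth of the coefficients `c` that a vertex of the tree
assigns to its ancestors, and of their differences `d`. -/
theorem distortion_omegaTree_le {p : ℝ≥0∞} [Fact (1 ≤ p)] (h : HasLpAsymptoticModel Y p) (k : ℕ)
    {c d : ℕ → ℝ} (hd0 : d 0 = c 0) (hd : ∀ j, d (j + 1) = c (j + 1) - c j) {K κ : ℝ}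
    (hK : 0 ≤ K) (hκ : 0 < κ)
    (hup : ∀ l < k, ‖WithLp.toLp p (fun i : Fin k => if (i : ℕ) < l + 1 then d (l - i) else 0)‖ ≤ K)
    (hlow : ∀ m l, m < l → l ≤ k → κ * ((l - m : ℕ) : ℝ) ≤ ‖WithLp.toLp p (fun i : Fin k =>
      if (i : ℕ) < l then (if m ≤ (i : ℕ) then c (l - (i + 1)) else 0) else 0)‖) :
    distortion Y (OmegaTree k) ≤ ENNReal.ofReal (4 * (K + κ) / κ) := by
  classical
  let M : ℝ := 1 + ∑ j ∈ Finset.range k, |c j| + ∑ j ∈ Finset.range k, |d j|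
  have hc0 : 0 ≤ ∑ j ∈ Finset.range k, |c j| := Finset.sum_nonneg fun _ _ => abs_nonneg _
  have hd0' : 0 ≤ ∑ j ∈ Finset.range k, |d j| := Finset.sum_nonneg fun _ _ => abs_nonneg _
  have hM : 0 < M := by positivity
  have hcM : ∀ j < k, |c j| ≤ M := fun j hj => by
    have := Finset.single_le_sum (f := fun j => |c j|) (fun _ _ => abs_nonneg _)
      (Finset.mem_range.2 hj)
    simp only [M]
    linarith
  have hdM : ∀ j < k, |d j| ≤ M := fun j hj => by
    have := Finset.single_le_sum (f := fun j => |d j|) (fun _ _ => abs_nonneg _)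
      (Finset.mem_range.2 hj)
    simp only [M]
    linarith
  obtain ⟨z, ⟨hz1, hz2⟩, hz⟩ := h.exists_array k hM (show 0 < κ / 8 by positivity)
  -- A label is a row together with a coefficient. The coefficients of `f s - f t` are differences
  -- of elements of `C`, with `0` for a segment off the branch, so finitely many labels suffice.
  let u : ℕ × ℝ → ℕ → Y := fun a n => a.2 • z a.1 n
  let C : Finset ℝ := insert 0 ((Finset.range k).image c)
  have hC : ∀ j < k, c j ∈ C := fun j hj =>
    Finset.mem_insert_of_mem (Finset.mem_image_of_mem _ (Finset.mem_range.2 hj))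
  have hC0 : (0 : ℝ) ∈ C := Finset.mem_insert_self _ _
  let T : Finset (ℕ × ℝ) := Finset.range k ×ˢ Finset.image₂ (· - ·) C C
  -- The shift by `k` keeps all columns in the range where the model applies.
  let code : Finset ℕ → ℕ := fun v => k + binaryCode v
  have hcode : Function.Injective code := fun v w hvw => binaryCode_injective (by
    simp only [code] at hvw; omega)
  obtain ⟨φ, hφ, hsupp⟩ := exists_subseq_suppression (u := u)
    (fun a => ⟨|a.2|, fun n => by simp [u, norm_smul, hz1]⟩)
    (fun a ψ => by simpa [u] using (hz2 a.1 ψ).const_mul a.2) T (2 * k)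
    (show 0 < κ / 8 by positivity) hcode
  let g : Finset ℕ → ℕ := fun v => φ (code v)
  have hg : ∀ v w, v ⊂ w → g v < g w := fun v w hvw =>
    hφ (Nat.add_lt_add_left (binaryCode_lt hvw) k)
  have hgk : ∀ v, k ≤ g v := fun v => (Nat.le_add_right k _).trans (hφ.le_apply)
  have hbr := fun (s : Finset ℕ) (hs : s.card ≤ k) => abs_norm_branch_sub_lt hM.le hz hg hgk hs
  let f : Finset ℕ → Y := fun s =>
    ∑ i ∈ Finset.range s.card, c (s.card - (i + 1)) • z i (g (seg s (i + 1)))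
  have hfb : ∀ s (b : Finset ℕ → ℝ), ∑ v ∈ branch s, b v • z (v.card - 1) (g v) =
      ∑ i ∈ Finset.range s.card, b (seg s (i + 1)) • z i (g (seg s (i + 1))) := by
    intro s b
    rw [sum_branch]
    refine Finset.sum_congr rfl fun i hi => ?_
    rw [card_seg (Finset.mem_range.1 hi), Nat.succ_sub_one]
  have hf : ∀ s, f s = ∑ v ∈ branch s, c (s.card - v.card) • z (v.card - 1) (g v) := by
    intro s
    rw [hfb s fun v => c (s.card - v.card)]
    refine Finset.sum_congr rfl fun i hi => ?_
    rw [card_seg (Finset.mem_range.1 hi)]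
  have hlower : ∀ (s t : Finset ℕ), s.card ≤ k → t.card ≤ k → ∀ m, m ≤ s.card →
      (∀ i < s.card, seg s (i + 1) ∈ branch t ↔ i < m) →
      κ * ((s.card - m : ℕ) : ℝ) - κ / 4 ≤ ‖f s - f t‖ := by
    intro s t hs ht m hm hiff
    rcases hm.eq_or_lt with rfl | hm
    · simp only [Nat.sub_self, Nat.cast_zero, mul_zero]
      have := norm_nonneg (f s - f t)
      linarith
    let b : Finset ℕ → Finset ℕ → ℝ := fun r v => if v ∈ branch r then c (r.card - v.card) else 0
    let ℓ : Finset ℕ → ℕ × ℝ := fun v => (v.card - 1, b s v - b t v)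
    have hbC : ∀ r v, r.card ≤ k → b r v ∈ C := by
      intro r v hr
      simp only [b]
      split_ifs with hv
      · have := card_of_mem_branch hv
        exact hC _ (by omega)
      · exact hC0
    -- Keeping only the part of the branch of `s` beyond the meet costs `κ / 8`; the model estimate
    -- below costs another `κ / 8`.
    have hF := hsupp ℓ (branch s ∪ branch t) (branch s \ branch t)
      (Finset.sdiff_subset.trans Finset.subset_union_left)
      ((Finset.card_union_le _ _).trans (by
        have := card_branch_le s
        have := card_branch_le t
        omega))
      (fun v hv => by
        refine Finset.mem_product.2 ⟨Finset.mem_range.2 ?_,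
          Finset.mem_image₂_of_mem (hbC s v hs) (hbC t v ht)⟩
        change v.card - 1 < k
        rcases Finset.mem_union.1 hv with hv | hv
        · have := card_of_mem_branch hv
          omega
        · have := card_of_mem_branch hv
          omega)
    have hbsum : ∀ r, branch r ⊆ branch s ∪ branch t →
        ∑ v ∈ branch s ∪ branch t, b r v • z (v.card - 1) (g v) = f r := by
      intro r hr
      rw [hf, ← Finset.sum_subset hr fun v _ hv => by simp only [b, if_neg hv, zero_smul]]
      exact Finset.sum_congr rfl fun v hv => by simp only [b, if_pos hv]
    have h1 : ∑ v ∈ branch s ∪ branch t, u (ℓ v) (φ (code v)) = f s - f t := by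
      rw [← hbsum s Finset.subset_union_left, ← hbsum t Finset.subset_union_right,
        ← Finset.sum_sub_distrib]
      exact Finset.sum_congr rfl fun v _ => sub_smul _ _ _
    have h2 : ∑ v ∈ branch s \ branch t, u (ℓ v) (φ (code v)) =
        ∑ i ∈ Finset.range s.card,
          (if m ≤ i then c (s.card - (i + 1)) else 0) • z i (g (seg s (i + 1))) := by
      have h3 : ∑ v ∈ branch s \ branch t, u (ℓ v) (φ (code v)) = ∑ v ∈ branch s,
          (if v ∈ branch t then 0 else c (s.card - v.card)) • z (v.card - 1) (g v) := by
        rw [← Finset.sum_subset (Finset.sdiff_subset (s := branch s) (t := branch t))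
          fun v hv hv' => by
            rw [if_pos (by simpa [hv] using hv'), zero_smul]]
        refine Finset.sum_congr rfl fun v hv => ?_
        obtain ⟨hv1, hv2⟩ := Finset.mem_sdiff.1 hv
        simp only [u, ℓ, b, if_pos hv1, if_neg hv2, sub_zero, g]
      rw [h3, hfb s fun v => if v ∈ branch t then 0 else c (s.card - v.card)]
      refine Finset.sum_congr rfl fun i hi => ?_
      have hi' := Finset.mem_range.1 hi
      simp only [hiff i hi', card_seg hi', ← not_lt, ite_not]
    rw [h1, h2] at hF
    have h4 := abs_lt.1 (hbr s hs (fun i => if m ≤ i then c (s.card - (i + 1)) else 0) fun i hi => by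
      split_ifs
      · exact hcM _ (by omega)
      · simpa using hM.le)
    have h5 := hlow m s.card hm hs
    linarith [h4.1]
  have hupper : ∀ s t : OmegaTree k, s.IsChild t → dist (f s.1) (f t.1) ≤ K + κ := by
    rintro ⟨s, hs⟩ ⟨t, ht⟩ ⟨n, hn, hst⟩
    simp only at hn hst ⊢
    have hcard : t.card = s.card + 1 := by
      rw [hst]
      exact Finset.card_insert_of_notMem fun hns => lt_irrefl _ (hn n hns)
    have hseg : ∀ i < s.card, seg s (i + 1) = seg t (i + 1) := fun i hi => by
      have h1 : seg t s.card = s := by rw [hst]; exact seg_insert hn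
      conv_lhs => rw [← h1]
      exact seg_seg t hi
    have h1 : f t - f s = ∑ i ∈ Finset.range t.card, d (s.card - i) • z i (g (seg t (i + 1))) := by
      simp only [f]
      rw [hcard, Finset.sum_range_succ, Finset.sum_range_succ, add_sub_right_comm,
        ← Finset.sum_sub_distrib]
      congr 1
      · refine Finset.sum_congr rfl fun i hi => ?_
        have hi' := Finset.mem_range.1 hi
        rw [hseg i hi', ← sub_smul]
        congr 1
        obtain ⟨q, hq⟩ : ∃ q, s.card = i + 1 + q := ⟨_, (Nat.add_sub_cancel' hi').symm⟩
        rw [show s.card + 1 - (i + 1) = q + 1 by omega, show s.card - (i + 1) = q by omega,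
          show s.card - i = q + 1 by omega, hd]
      · rw [Nat.sub_self, Nat.sub_self, hd0]
    have h2 := abs_lt.1 (hbr t ht (fun i => d (s.card - i)) fun i hi => hdM _ (by omega))
    have h3 := hup s.card (by omega)
    rw [dist_comm, dist_eq_norm, h1]
    rw [hcard] at h2 ⊢
    linarith [h2.2]
  have hD : 0 ≤ 4 * (K + κ) / κ := by positivity
  -- Adding the lower bounds for `(s, t)` and `(t, s)` gives `2 ‖f s - f t‖ ≥ κ * dist s t - κ / 2`.
  -- Distinct vertices are at distance at least `1`, so this is at least `κ / 2 * dist s t`.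
  refine sInf_le ⟨(4 * (K + κ) / κ).toNNReal, rfl, κ / 4, by positivity, fun s => f s.1,
    fun s t => ⟨?_, ?_⟩⟩
  · by_cases hst : s = t
    · simp [hst]
    obtain ⟨m, hms, hmt, hm, his, hit⟩ := exists_meet s.1 t.1
    have h1 := hlower s.1 t.1 s.2 t.2 m hms his
    have h2 := hlower t.1 s.1 t.2 s.2 m hmt hit
    rw [norm_sub_rev] at h2
    have h3 := mul_le_mul_of_nonneg_left (OmegaTree.dist_le_of_seg_eq s t hms hmt hm) hκ.le
    have h4 := mul_le_mul_of_nonneg_left (OmegaTree.one_le_dist hst) hκ.le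
    rw [dist_eq_norm]
    linarith
  · have h1 := OmegaTree.dist_le_of_forall_isChild hupper s t
    rw [Real.coe_toNNReal _ hD, show κ / 4 * (4 * (K + κ) / κ) = K + κ by field_simp]
    exact h1

end Embedding

/-! ### Norms of the coefficient sequences -/

section Coefficients

theorem norm_toLp_ite {p : ℝ≥0∞} (hp : 0 < p.toReal) {k l : ℕ} (hl : l ≤ k) (a : ℕ → ℝ) :
    ‖WithLp.toLp p (fun i : Fin k => if (i : ℕ) < l then a i else 0)‖ =
      (∑ i ∈ Finset.range l, |a i| ^ p.toReal) ^ (1 / p.toReal) := by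
  rw [PiLp.norm_eq_sum hp]
  congr 1
  have h := Fin.sum_univ_eq_sum_range (fun i => ‖if i < l then a i else 0‖ ^ p.toReal) k
  refine h.trans ?_
  rw [← Finset.sum_subset (Finset.range_subset_range.2 hl) fun i _ hi => by
    rw [if_neg (by simpa using hi), norm_zero, Real.zero_rpow hp.ne']]
  refine Finset.sum_congr rfl fun i hi => ?_
  rw [if_pos (Finset.mem_range.1 hi), Real.norm_eq_abs]

theorem norm_toLp_ite_reverse {p : ℝ≥0∞} (hp : 0 < p.toReal) {k l : ℕ} (hl : l < k) (d : ℕ → ℝ) :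
    ‖WithLp.toLp p (fun i : Fin k => if (i : ℕ) < l + 1 then d (l - i) else 0)‖ =
      (∑ i ∈ Finset.range (l + 1), |d i| ^ p.toReal) ^ (1 / p.toReal) := by
  rw [norm_toLp_ite hp hl fun i => d (l - i),
    ← Finset.sum_range_reflect (fun i => |d i| ^ p.toReal)]
  simp

theorem le_norm_toLp_ite {p : ℝ≥0∞} (hp : 0 < p.toReal) {k m l : ℕ} (hml : m < l) (hl : l ≤ k)
    (c : ℕ → ℝ) :
    (∑ j ∈ Finset.range (l - m), |c j| ^ p.toReal) ^ (1 / p.toReal) ≤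
      ‖WithLp.toLp p (fun i : Fin k =>
        if (i : ℕ) < l then (if m ≤ (i : ℕ) then c (l - (i + 1)) else 0) else 0)‖ := by
  rw [norm_toLp_ite hp hl fun i => if m ≤ i then c (l - (i + 1)) else 0]
  refine Real.rpow_le_rpow (Finset.sum_nonneg fun _ _ => by positivity) ?_ (by positivity)
  rw [← Finset.sum_range_reflect _ l]
  refine (Finset.sum_le_sum fun j hj => ?_).trans (Finset.sum_le_sum_of_subset_of_nonneg
    (Finset.range_subset_range.2 (Nat.sub_le l m)) fun _ _ _ => by positivity)
  have := Finset.mem_range.1 hj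
  rw [if_pos (by omega), show l - (l - 1 - j + 1) = j by omega]

/-- Write `x ^ q = x ^ (q - 1) * x` and use that `x ^ (q - 1)` is nonincreasing. -/
theorem rpow_succ_sub_rpow_le {q : ℝ} (hq1 : q ≤ 1) (j : ℕ) (hj : 1 ≤ j) :
    ((j : ℝ) + 1) ^ q - (j : ℝ) ^ q ≤ ((j : ℝ) + 1) ^ (q - 1) := by
  have hj' : (0 : ℝ) < j := by exact_mod_cast hj
  have h1 : ((j : ℝ) + 1) ^ (q - 1) ≤ (j : ℝ) ^ (q - 1) :=
    Real.rpow_le_rpow_of_nonpos hj' (by linarith) (by linarith)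
  have h2 : ((j : ℝ) + 1) ^ q = ((j : ℝ) + 1) ^ (q - 1) * (j + 1) := by
    rw [← Real.rpow_add_one (by positivity)]; ring_nf
  have h3 : (j : ℝ) ^ q = (j : ℝ) ^ (q - 1) * j := by
    rw [← Real.rpow_add_one (by positivity)]; ring_nf
  rw [h2, h3]
  nlinarith

/-- Pair `j` with `L - 1 - j`: one of `j + 1` and `L - j` is at least `L / 2`. -/
theorem half_rpow_le_sum {p : ℝ} (hp : 1 ≤ p) (L : ℕ) :
    ((L : ℝ) / 2) ^ p ≤ ∑ j ∈ Finset.range L, ((j : ℝ) + 1) ^ (p - 1) := by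
  rcases Nat.eq_zero_or_pos L with rfl | hL
  · simp [Real.zero_rpow (by linarith : p ≠ 0)]
  have h1 : ∀ j ∈ Finset.range L, ((L : ℝ) / 2) ^ (p - 1) ≤
      ((j : ℝ) + 1) ^ (p - 1) + (((L - 1 - j : ℕ) : ℝ) + 1) ^ (p - 1) := by
    intro j hj
    have hj' := Finset.mem_range.1 hj
    have e : (((L - 1 - j : ℕ) : ℝ) + 1) = L - j := by
      rw [← Nat.cast_add_one, show L - 1 - j + 1 = L - j by omega, Nat.cast_sub hj'.le]
    have hjL : (j : ℝ) ≤ L := by exact_mod_cast hj'.le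
    rw [e]
    rcases le_total ((L : ℝ) / 2) j with h | h
    · have h2 : ((L : ℝ) / 2) ^ (p - 1) ≤ ((j : ℝ) + 1) ^ (p - 1) :=
        Real.rpow_le_rpow (by positivity) (by linarith) (by linarith)
      have : 0 ≤ ((L : ℝ) - j) ^ (p - 1) := Real.rpow_nonneg (by linarith) _
      linarith
    · have h2 : ((L : ℝ) / 2) ^ (p - 1) ≤ ((L : ℝ) - j) ^ (p - 1) :=
        Real.rpow_le_rpow (by positivity) (by linarith) (by linarith)
      have : 0 ≤ ((j : ℝ) + 1) ^ (p - 1) := by positivity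
      linarith
  have h2 := Finset.sum_le_sum h1
  rw [Finset.sum_add_distrib, Finset.sum_range_reflect (fun j => ((j : ℝ) + 1) ^ (p - 1)) L,
    Finset.sum_const, Finset.card_range, nsmul_eq_mul] at h2
  have h3 : ((L : ℝ) / 2) ^ p = ((L : ℝ) / 2) ^ (p - 1) * (L / 2) := by
    rw [← Real.rpow_add_one (by positivity)]; ring_nf
  rw [h3]
  linarith

theorem sum_inv_succ_le (n : ℕ) :
    ∑ j ∈ Finset.range n, ((j : ℝ) + 1)⁻¹ ≤ 1 + Real.log n := by
  have := harmonic_le_one_add_log n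
  simpa [harmonic] using this

end Coefficients

/-! ### Choice of coefficients for each `p` -/

section Distortion

variable {Y : Type*} [NormedAddCommGroup Y] [NormedSpace ℝ Y]

theorem HasLpAsymptoticModel.distortion_le_log {p : ℝ} (hp : 1 < p)
    (h : HasLpAsymptoticModel Y (ENNReal.ofReal p)) (k : ℕ) :
    distortion Y (OmegaTree k) ≤ ENNReal.ofReal (8 * (1 + Real.log k) ^ (1 / p) + 4) := by
  have hp0 : 0 < p := by linarith
  have : Fact (1 ≤ ENNReal.ofReal p) := ⟨by simpa using hp.le⟩
  have hpr : (ENNReal.ofReal p).toReal = p := ENNReal.toReal_ofReal hp0.le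
  have hpr0 : 0 < (ENNReal.ofReal p).toReal := by rwa [hpr]
  have hlog : 0 ≤ Real.log k := Real.log_natCast_nonneg k
  -- This exponent satisfies `(q - 1) * p = -1`, giving the harmonic sum for `d`, and `q * p = p -
  -- 1`, giving linear growth of the norm of `c`.
  let q : ℝ := 1 - 1 / p
  have hq1 : q ≤ 1 := by simp only [q]; linarith [one_div_pos.2 hp0]
  have hq0 : 0 ≤ q := by
    simp only [q]
    linarith [(div_le_one hp0).2 hp.le]
  have hqp : q * p = p - 1 := by simp only [q]; field_simp
  let c : ℕ → ℝ := fun j => ((j : ℝ) + 1) ^ q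
  let d : ℕ → ℝ := fun j => c j - if j = 0 then 0 else c (j - 1)
  have hd : ∀ j, |d j| ^ p ≤ ((j : ℝ) + 1)⁻¹ := by
    intro j
    have hj1 : (0 : ℝ) < (j : ℝ) + 1 := by positivity
    have h1 : 0 ≤ d j ∧ d j ≤ ((j : ℝ) + 1) ^ (q - 1) := by
      cases j with
      | zero => simp [d, c]
      | succ j =>
        have h2 := rpow_succ_sub_rpow_le hq1 (j + 1) (by omega)
        have h3 : ((j : ℝ) + 1) ^ q ≤ ((j : ℝ) + 1 + 1) ^ q :=
          Real.rpow_le_rpow (by positivity) (by linarith) hq0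
        simp only [d, c, if_neg (Nat.succ_ne_zero j), Nat.add_sub_cancel]
        push_cast at h2 ⊢
        exact ⟨by linarith, h2⟩
    rw [abs_of_nonneg h1.1]
    refine (Real.rpow_le_rpow h1.1 h1.2 hp0.le).trans_eq ?_
    rw [← Real.rpow_mul hj1.le, ← Real.rpow_neg_one]
    congr 1
    linarith
  have main := distortion_omegaTree_le h k (c := c) (d := d) (K := (1 + Real.log k) ^ (1 / p))
    (κ := 1 / 2) (by simp [d]) (fun j => by simp [d]) (by positivity) (by norm_num) ?_ ?_
  · refine main.trans_eq (congrArg _ ?_)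
    ring
  · intro l hl
    rw [norm_toLp_ite_reverse hpr0 hl, hpr]
    refine Real.rpow_le_rpow (Finset.sum_nonneg fun _ _ => by positivity) ?_ (by positivity)
    refine (Finset.sum_le_sum fun j _ => hd j).trans ((sum_inv_succ_le _).trans ?_)
    have := Real.log_le_log (by positivity : (0 : ℝ) < ((l + 1 : ℕ) : ℝ))
      (by exact_mod_cast hl : ((l + 1 : ℕ) : ℝ) ≤ k)
    linarith
  · intro m l hml hl
    refine le_trans ?_ (le_norm_toLp_ite hpr0 hml hl c)
    rw [hpr]
    have h1 : ∀ j : ℕ, |c j| ^ p = ((j : ℝ) + 1) ^ (p - 1) := fun j => by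
      have hj1 : (0 : ℝ) < (j : ℝ) + 1 := by positivity
      simp only [c]
      rw [abs_of_pos (by positivity), ← Real.rpow_mul hj1.le, hqp]
    simp only [h1]
    refine le_trans ?_ (Real.rpow_le_rpow (by positivity) (half_rpow_le_sum hp.le (l - m))
      (by positivity))
    rw [one_div p, Real.rpow_rpow_inv (by positivity) hp0.ne']
    linarith

theorem HasLpAsymptoticModel.distortion_le_of_one (h : HasLpAsymptoticModel Y 1) (k : ℕ) :
    distortion Y (OmegaTree k) ≤ ENNReal.ofReal 8 := by
  have hp : 0 < (1 : ℝ≥0∞).toReal := by simp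
  have main := distortion_omegaTree_le h k (c := fun _ => 1) (d := fun j => if j = 0 then 1 else 0)
    (K := 1) (κ := 1) (by simp) (fun j => by simp) (by norm_num) (by norm_num) ?_ ?_
  · refine main.trans_eq ?_
    norm_num
  · intro l hl
    rw [norm_toLp_ite_reverse hp hl fun j => if j = 0 then 1 else 0]
    simp [Finset.sum_range_succ']
  · intro m l hml hl
    refine le_trans ?_ (le_norm_toLp_ite hp hml hl fun _ => 1)
    simp

theorem HasLpAsymptoticModel.distortion_le_of_top (h : HasLpAsymptoticModel Y ∞) (k : ℕ) :
    distortion Y (OmegaTree k) ≤ ENNReal.ofReal 8 := by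
  have main := distortion_omegaTree_le h k (c := fun j => (j : ℝ) + 1) (d := fun _ => 1)
    (K := 1) (κ := 1) (by simp) (fun j => by push_cast; ring) (by norm_num) (by norm_num) ?_ ?_
  · refine main.trans_eq ?_
    norm_num
  · intro l hl
    rw [PiLp.norm_eq_ciSup]
    refine Real.iSup_le (fun i => ?_) zero_le_one
    dsimp only
    split_ifs <;> simp
  · intro m l hml hl
    rw [PiLp.norm_eq_ciSup]
    -- Coordinate `m`, the first beyond the meet, carries the largest coefficient, `l - m`.
    refine le_trans ?_ (le_ciSup (Set.finite_range _).bddAbove (⟨m, by omega⟩ : Fin k))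
    dsimp only
    rw [if_pos hml, if_pos le_rfl, one_mul]
    refine le_trans ?_ (le_abs_self _)
    rw [← Nat.cast_add_one, show l - (m + 1) + 1 = l - m by omega]

end Distortion

theorem mainTheorem12 (Y : Type*) [NormedAddCommGroup Y] [NormedSpace ℝ Y] [CompleteSpace Y] :
    (∀ p : ℝ, 1 < p → HasLpAsymptoticModel Y (ENNReal.ofReal p) →
      ∃ C : ℝ, 0 < C ∧ ∀ k : ℕ, 2 ≤ k →
        distortion Y (OmegaTree k) ≤ ENNReal.ofReal (C * (Real.log k) ^ (1 / p))) ∧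
    (HasLpAsymptoticModel Y 1 ∨ HasLpAsymptoticModel Y ∞ →
      (⨆ k : ℕ, distortion Y (OmegaTree k)) < ∞) := by
  -- Here `32 = 8 * 3 + 4 * 2`: since `log k ≥ 1 / 2`, one has `1 + log k ≤ 3 * log k` and `1 ≤ 2 *
  -- log k`.
  refine ⟨fun p hp h => ⟨32, by norm_num, fun k hk => ?_⟩, fun h => ?_⟩
  · refine (h.distortion_le_log hp k).trans (ENNReal.ofReal_le_ofReal ?_)
    have hp0 : 0 < p := by linarith
    have hk' : (2 : ℝ) ≤ k := by exact_mod_cast hk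
    have hlog : 1 / 2 ≤ Real.log k := by
      have := Real.log_le_log (by norm_num) hk'
      linarith [Real.log_two_gt_d9]
    have hscale : ∀ A : ℝ, 1 ≤ A → (A * Real.log k) ^ (1 / p) ≤ A * Real.log k ^ (1 / p) := by
      intro A hA
      rw [Real.mul_rpow (by linarith) (by linarith)]
      refine mul_le_mul_of_nonneg_right ?_ (Real.rpow_nonneg (by linarith) _)
      exact Real.rpow_le_self_of_one_le hA ((div_le_one hp0).2 hp.le)
    have h1 : (1 + Real.log k) ^ (1 / p) ≤ 3 * Real.log k ^ (1 / p) :=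
      (Real.rpow_le_rpow (by linarith) (by linarith) (by positivity)).trans
        (hscale 3 (by norm_num))
    have h2 : 1 ≤ 2 * Real.log k ^ (1 / p) :=
      (Real.one_le_rpow (by linarith) (by positivity)).trans (hscale 2 (by norm_num))
    linarith
  · refine lt_of_le_of_lt (iSup_le fun k => ?_) (ENNReal.ofReal_lt_top (r := 8))
    exact h.elim (fun h => h.distortion_le_of_one k) fun h => h.distortion_le_of_top k
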